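/- **Setting.** Let $d\in\mathbb N$, let $\Omega\subset\mathbb R^d$ be a bounded open set, and let $T>0$, $\gamma>0$. Let $H^1_0(\Omega)$ be the closure of $C_c^\infty(\Omega)$ in $H^1(\Omega)$, with the norm $\|f\|_{H^1_0(\Omega)}^2=\|f\|_{L_2(\Omega)}^2+\|\nabla f\|_{L_2(\Omega)}^2$, and let $H^{-1}(\Omega)$ be its dual. Let $\mathcal U\subset L_2(\Omega)$ be closed and convex with $0\in\mathcal U$, and let $\mathbb U=L_2(0,T;\mathcal U)$ be the set of $u\in L_2(0,T;L_2(\Omega))$ with $u(t)\in\mathcal U$ for a.e. $t$. Let $K\subset H^1_0(\Omega)$ be weakly closed and contain at least one element of norm at most $1$. For a measurable set $\omega\subset\Omega$ (an actuator), $u\in\mathbb U$ and $f\in H^1_0(\Omega)$, let $y^{u,f,\omega}$ be the weak solution of $\partial_t y-\Delta y=\chi_\omega u$ in $\Omega\times(0,T]$, $y=0$ on $\partial\Omega\times(0,T]$, $y(0)=f$ in $\Omega$. That is, $y\in L_2(0,T;H^1_0(\Omega))$ has a weak derivative $\partial_t y\in L_2(0,T;H^{-1}(\Omega))$, $$\langle\partial_t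 y,\varphi\rangle_{H^{-1},H^1_0}+\int_\Omega\nabla y\cdot\nabla\varphi\,dx=\int_\Omega\chi_\omega u\,\varphi\,dx$$ for a.e. $t\in(0,T]$ and all $\varphi\in H^1_0(\Omega)$, and the representative of $y$ in $C([0,T];L_2(\Omega))$ takes the value $f$ at $t=0$. Put $$J(\omega,u,f)=\int_0^T\|y^{u,f,\omega}(t)\|_{L_2(\Omega)}^2+\gamma\|u(t)\|_{L_2(\Omega)}^2\,dt,\qquad \mathcal J_1(\omega,f)=\inf_{u\in\mathbb U}J(\omega,u,f),\qquad \mathcal J_2(\omega)=\sup_{f\in K,\ \|f\|_{H^1_0(\Omega)}\le1}\mathcal J_1(\omega,f).$$ **Lemma.** For every measurable $\omega\subset\Omega$, the supremum $\mathcal J_2(\omega)$ is finite and attained: there is $f\in K$ with $\|f\|_{H^1_0(\Omega)}\le1$ and $\mathcal J_2(\omega)=\mathcal J_1(\omega,f)$. -/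

import Mathlib

open MeasureTheory Set TopologicalSpace
open scoped ENNReal Distributions Gradient

noncomputable section

namespace HeatActuator

/-- Euclidean space `ℝ^d`. -/
abbrev E (d : ℕ) : Type := EuclideanSpace ℝ (Fin d)

/-- `L₂(Ω)`. -/
abbrev L2 {d : ℕ} (Ω : Opens (E d)) : Type :=
  Lp ℝ 2 ((volume : Measure (E d)).restrict (Ω : Set (E d)))

/-- `L₂(Ω; ℝ^d)`. -/
abbrev L2Vec {d : ℕ} (Ω : Opens (E d)) : Type :=
  Lp (E d) 2 ((volume : Measure (E d)).restrict (Ω : Set (E d)))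

/-- The Hilbert space `L₂(Ω) × L₂(Ω; ℝ^d)` with norm `(‖p₁‖² + ‖p₂‖²)^(1/2)`. On pairs
`(f, ∇f)` this is the `H¹(Ω)` norm. -/
abbrev Ambient {d : ℕ} (Ω : Opens (E d)) : Type := WithLp 2 (L2 Ω × L2Vec Ω)

lemma test_differentiable {d : ℕ} {Ω : Opens (E d)} (φ : 𝓓(Ω, ℝ)) (x : E d) :
    DifferentiableAt ℝ (φ : E d → ℝ) x :=
  (φ.contDiff.differentiable (by simp)) x

/-- The pairs `(φ, ∇φ)` with `φ` a smooth function with compact support in `Ω`. -/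
def testPairs {d : ℕ} (Ω : Opens (E d)) : Submodule ℝ (Ambient Ω) where
  carrier := {p | ∃ φ : 𝓓(Ω, ℝ),
    (∀ᵐ x ∂((volume : Measure (E d)).restrict (Ω : Set (E d))), p.fst x = φ x) ∧
    (∀ᵐ x ∂((volume : Measure (E d)).restrict (Ω : Set (E d))),
      p.snd x = ∇ (φ : E d → ℝ) x)}
  zero_mem' := by
    refine ⟨0, ?_, ?_⟩
    · filter_upwards [Lp.coeFn_zero ℝ 2 ((volume : Measure (E d)).restrict (Ω : Set (E d)))]
        with x hx
      simpa using hx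
    · filter_upwards [Lp.coeFn_zero (E d) 2
        ((volume : Measure (E d)).restrict (Ω : Set (E d)))] with x hx
      have h0 : ((0 : 𝓓(Ω, ℝ)) : E d → ℝ) = fun _ => 0 := rfl
      rw [h0, gradient_fun_const]
      simpa using hx
  add_mem' := by
    rintro p q ⟨φ, hp1, hp2⟩ ⟨ψ, hq1, hq2⟩
    refine ⟨φ + ψ, ?_, ?_⟩
    · filter_upwards [hp1, hq1, Lp.coeFn_add p.fst q.fst] with x h1 h2 h3
      rw [WithLp.add_fst, h3, Pi.add_apply, h1, h2]
      rfl
    · filter_upwards [hp2, hq2, Lp.coeFn_add p.snd q.snd] with x h1 h2 h3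
      rw [WithLp.add_snd, h3, Pi.add_apply, h1, h2]
      have h0 : ((φ + ψ : 𝓓(Ω, ℝ)) : E d → ℝ) = (φ : E d → ℝ) + (ψ : E d → ℝ) := rfl
      rw [h0, gradient, gradient, gradient,
        fderiv_add (test_differentiable φ x) (test_differentiable ψ x), map_add]
  smul_mem' := by
    rintro c p ⟨φ, hp1, hp2⟩
    refine ⟨c • φ, ?_, ?_⟩
    · filter_upwards [hp1, Lp.coeFn_smul c p.fst] with x h1 h3
      rw [WithLp.smul_fst, h3, Pi.smul_apply, h1]
      rfl
    · filter_upwards [hp2, Lp.coeFn_smul c p.snd] with x h1 h3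
      rw [WithLp.smul_snd, h3, Pi.smul_apply, h1]
      have h0 : ((c • φ : 𝓓(Ω, ℝ)) : E d → ℝ) = c • (φ : E d → ℝ) := rfl
      rw [h0, gradient, gradient, fderiv_const_smul (test_differentiable φ x)]
      simp

/-- The Sobolev space `H¹₀(Ω)`: the closure of the smooth functions with compact support in `Ω`
with respect to the `H¹(Ω)` norm. An element is the pair consisting of the function and its weak
gradient; the norm inherited from `Ambient Ω` is the `H¹(Ω)` norm. -/
abbrev H10 {d : ℕ} (Ω : Opens (E d)) : Type := ↥(testPairs Ω).topologicalClosure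

/-- The inclusion `H¹₀(Ω) → L₂(Ω)`. -/
def toL2 {d : ℕ} (Ω : Opens (E d)) : H10 Ω →L[ℝ] L2 Ω :=
  (WithLp.fstL 2 ℝ (L2 Ω) (L2Vec Ω)).comp (testPairs Ω).topologicalClosure.subtypeL

/-- The weak gradient `H¹₀(Ω) → L₂(Ω; ℝ^d)`. -/
def grad {d : ℕ} (Ω : Opens (E d)) : H10 Ω →L[ℝ] L2Vec Ω :=
  (WithLp.sndL 2 ℝ (L2 Ω) (L2Vec Ω)).comp (testPairs Ω).topologicalClosure.subtypeL

/-- `H⁻¹(Ω)`, the dual of `H¹₀(Ω)`. -/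
abbrev Hneg1 {d : ℕ} (Ω : Opens (E d)) : Type := StrongDual ℝ (H10 Ω)

/-- The embedding `L₂(Ω) → H⁻¹(Ω)`, `v ↦ (φ ↦ (v, φ)_{L₂(Ω)})`. -/
def toHneg1 {d : ℕ} (Ω : Opens (E d)) (v : L2 Ω) : Hneg1 Ω := (innerSL ℝ v).comp (toL2 Ω)

/-- The Bochner space `L₂(0,T;X)`. -/
abbrev L2Time (T : ℝ) (X : Type) [NormedAddCommGroup X] : Type :=
  Lp X 2 ((volume : Measure ℝ).restrict (Ioc 0 T))

/-- The open interval `(0,T)`. -/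
def timeInterval (T : ℝ) : Opens ℝ := ⟨Ioo 0 T, isOpen_Ioo⟩

/-- `y' ∈ L₂(0,T;H⁻¹(Ω))` is the weak time derivative of `y ∈ L₂(0,T;H¹₀(Ω))`. -/
def IsWeakTimeDeriv {d : ℕ} (Ω : Opens (E d)) (T : ℝ) (y : L2Time T (H10 Ω))
    (y' : L2Time T (Hneg1 Ω)) : Prop :=
  ∀ ψ : 𝓓(timeInterval T, ℝ),
    ∫ t in Ioc 0 T, deriv (ψ : ℝ → ℝ) t • toHneg1 Ω (toL2 Ω (y t))
      = -∫ t in Ioc 0 T, ψ t • y' t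

/-- `y` is a weak solution in `W(0,T)` of `∂ₜy - Δy = χ_ω u` in `Ω × (0,T]`, `y = 0` on
`∂Ω × (0,T]`, `y(0) = f`. The initial condition is meant for the representative of `y` in
`C([0,T]; L₂(Ω))`. -/
def IsWeakSolution {d : ℕ} (Ω : Opens (E d)) (T : ℝ) (ω : Set (E d)) (u : L2Time T (L2 Ω))
    (f : H10 Ω) (y : L2Time T (H10 Ω)) : Prop :=
  (∃ y' : L2Time T (Hneg1 Ω), IsWeakTimeDeriv Ω T y y' ∧
    ∀ᵐ t ∂((volume : Measure ℝ).restrict (Ioc 0 T)), ∀ φ : H10 Ω,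
      y' t φ + inner ℝ (grad Ω (y t)) (grad Ω φ)
        = ∫ x in (Ω : Set (E d)), ω.indicator (u t) x * toL2 Ω φ x) ∧
  (∃ yc : ℝ → L2 Ω, ContinuousOn yc (Icc 0 T) ∧
    (∀ᵐ t ∂((volume : Measure ℝ).restrict (Ioc 0 T)), yc t = toL2 Ω (y t)) ∧
    yc 0 = toL2 Ω f)

/-- The controls `L₂(0,T;U)`, for `U` a subset of `L₂(Ω)`. -/
def controls {d : ℕ} (Ω : Opens (E d)) (T : ℝ) (U : Set (L2 Ω)) : Set (L2Time T (L2 Ω)) :=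
  {u | ∀ᵐ t ∂((volume : Measure ℝ).restrict (Ioc 0 T)), u t ∈ U}

/-- The cost `J(ω,u,f) = ∫₀ᵀ ‖y(t)‖² + γ ‖u(t)‖² dt`, where `y` is the weak solution for the data
`(ω,u,f)`. The state equation enters as a constraint: the infimum ranges over the weak solutions
`y`, of which there is exactly one (and it would be `∞`, not a finite number, were there none). -/
def J {d : ℕ} (Ω : Opens (E d)) (T γ : ℝ) (ω : Set (E d)) (u : L2Time T (L2 Ω)) (f : H10 Ω) :
    ℝ≥0∞ :=
  ⨅ (y : L2Time T (H10 Ω)) (_ : IsWeakSolution Ω T ω u f y),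
    ∫⁻ t in Ioc 0 T, (‖toL2 Ω (y t)‖ₑ ^ 2 + ENNReal.ofReal γ * ‖u t‖ₑ ^ 2)

/-- `𝒥₁(ω,f)`, the infimum of `J(ω,u,f)` over the controls `u ∈ L₂(0,T;U)`. -/
def J1 {d : ℕ} (Ω : Opens (E d)) (T γ : ℝ) (U : Set (L2 Ω)) (ω : Set (E d)) (f : H10 Ω) :
    ℝ≥0∞ :=
  ⨅ u ∈ controls Ω T U, J Ω T γ ω u f

/-- `𝒥₂(ω)`, the supremum of `𝒥₁(ω,f)` over `f ∈ K` with `‖f‖_{H¹₀(Ω)} ≤ 1`. -/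
def J2 {d : ℕ} (Ω : Opens (E d)) (T γ : ℝ) (U : Set (L2 Ω)) (K : Set (H10 Ω))
    (ω : Set (E d)) : ℝ≥0∞ :=
  ⨆ (f : H10 Ω) (_ : f ∈ K ∧ ‖f‖ ≤ 1), J1 Ω T γ U ω f

end HeatActuator

end

/-!
The functional `J1 Ω T γ U ω` is upper semicontinuous along sequences of initial data whose
images under `toL2 Ω` converge, and `toL2 Ω` turns weak convergence into norm convergence (Rellich).
A maximizing sequence in `K ∩ {‖f‖ ≤ 1}` has a weakly convergent subsequence, whose limit lies in `K`
and in the unit ball, and upper semicontinuity shows that the limit attains the supremum.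

*Upper semicontinuity.* If `y` solves the state equation for `(u, f)` and `z` solves the homogeneous
equation with initial value `f' - f`, then `y + z` solves it for `(u, f')`. Since
`‖toL2 (z t)‖ ≤ ‖toL2 (f' - f)‖`, Young's inequality gives, for every `δ > 0`,
`J1 f' ≤ (1 + δ) J1 f + (1 + δ⁻¹) T ‖toL2 (f' - f)‖²` (`J1_le_add`). As the cost is an infimum over
all weak solutions, neither uniqueness nor solvability for a general control is needed: only the
homogeneous equation has to be solved. The control `u = 0` gives `J1 f ≤ T ‖toL2 f‖²`, hence
finiteness.

*Homogeneous equation.* With `ι = toL2 Ω` and `S = ι* ι`, the Riesz isomorphism of `H¹₀(Ω)` turns the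
weak heat equation into `S z' = S z - z`, because `(∇z, ∇φ) = (z, φ)_{H¹} - (ιz, ιφ)`. The operator
`S` is compact and self-adjoint; on the eigenspace of an eigenvalue `μ ≠ 0` a solution is
`exp ((1 - μ⁻¹) t) v`. Both `‖z t‖` and `‖ι (z t)‖` decrease along solutions, so uniform limits of
such solutions exist for all initial values in the closed span of these eigenspaces; its orthogonal
complement is the kernel of `ι`, which the initial condition does not see (`exists_trajectory`).

*Rellich.* For a test function `φ`, comparison with its averages over balls of radius `ε` bounds
`‖φ‖²` by `2 ε² ‖∇φ‖²` plus a multiple of the square norm of the average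
(`lintegral_enorm_sq_le_average`). The average at a point is a bounded functional of `φ`, so along a
weak null sequence the averages tend to zero pointwise, and boundedly, hence in `L₂(Ω)`.
-/

namespace HeatActuator
open Filter Topology

/-! ### Weak sequential compactness in Hilbert spaces -/

section Hilbert

variable {V H : Type*} [NormedAddCommGroup V] [InnerProductSpace ℝ V] [CompleteSpace V]
  [NormedAddCommGroup H] [InnerProductSpace ℝ H]

/-- Sequential Banach–Alaoglu, transported to a separable Hilbert space by the Riesz isomorphism. -/
theorem exists_subseq_tendsto_inner [SeparableSpace V] {x : ℕ → V} {r : ℝ}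
    (hx : ∀ n, ‖x n‖ ≤ r) :
    ∃ a : V, ‖a‖ ≤ r ∧ ∃ σ : ℕ → ℕ, StrictMono σ ∧
      ∀ v, Tendsto (fun n => inner ℝ (x (σ n)) v) atTop (𝓝 (inner ℝ a v)) := by
  obtain ⟨b, hb, σ, hσ, hlim⟩ := WeakDual.isSeqCompact_closedBall ℝ V 0 r
    (x := fun n => StrongDual.toWeakDual (InnerProductSpace.toDual ℝ V (x n)))
    (fun n => by simpa using hx n)
  refine ⟨(InnerProductSpace.toDual ℝ V).symm (WeakDual.toStrongDual b), by simpa using hb,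
    σ, hσ, fun v => ?_⟩
  have h := ((WeakDual.eval_continuous v).tendsto b).comp hlim
  rw [InnerProductSpace.toDual_symm_apply]
  exact h

theorem tendsto_toWeakSpace {x : ℕ → V} {a : V}
    (h : ∀ v, Tendsto (fun n => inner ℝ (x n) v) atTop (𝓝 (inner ℝ a v))) :
    Tendsto (fun n => toWeakSpace ℝ V (x n)) atTop (𝓝 (toWeakSpace ℝ V a)) := by
  refine (WeakBilin.tendsto_iff_forall_eval_tendsto (topDualPairing ℝ V).flip
    fun v w h => ext_inner_left ℝ fun x => LinearMap.congr_fun h (innerSL ℝ x)).2 fun l => ?_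
  have h' : Tendsto (fun n => l (x n)) atTop (𝓝 (l a)) := by
    have e : ∀ v, inner ℝ v ((InnerProductSpace.toDual ℝ V).symm l) = l v := fun v => by
      rw [real_inner_comm, InnerProductSpace.toDual_symm_apply]
    simpa only [e] using h ((InnerProductSpace.toDual ℝ V).symm l)
  exact h'

theorem isCompactOperator_of_tendsto_zero [SeparableSpace V] (ι : V →L[ℝ] H)
    (hι : ∀ (x : ℕ → V) (r : ℝ), (∀ n, ‖x n‖ ≤ r) →
      (∀ v, Tendsto (fun n => inner ℝ (x n) v) atTop (𝓝 0)) →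
      Tendsto (fun n => ι (x n)) atTop (𝓝 0)) :
    IsCompactOperator ι := by
  have hseq : IsSeqCompact (ι '' Metric.closedBall 0 1) := by
    intro y hy
    choose x hx hxy using hy
    obtain ⟨a, ha, σ, hσ, hlim⟩ := exists_subseq_tendsto_inner (x := x) (r := 1)
      (fun n => by simpa using hx n)
    refine ⟨ι a, ⟨a, by simpa using ha, rfl⟩, σ, hσ, ?_⟩
    have h := hι (fun n => x (σ n) - a) 2 (fun n => ?_) (fun v => ?_)
    · have := h.add_const (ι a)
      simpa [Function.comp_def, ← hxy] using this
    · have h1 : ‖x (σ n)‖ ≤ 1 := by simpa using hx (σ n)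
      exact (norm_sub_le _ _).trans (by linarith)
    · simpa [inner_sub_left] using (hlim v).sub_const (inner ℝ a v)
  exact ⟨_, hseq.isCompact, Filter.mem_of_superset (Metric.closedBall_mem_nhds 0 one_pos)
    (subset_preimage_image _ _)⟩

/-! ### The evolution equation attached to a compact embedding -/

section Evolution

variable [CompleteSpace H] (ι : V →L[ℝ] H)

/-- The operator `ι* ι` on `V`, which represents the form `(ι v, ι w)_H` in the inner product of
`V`. -/
noncomputable def gram : V →L[ℝ] V := (ContinuousLinearMap.adjoint ι).comp ι

theorem inner_gram (v w : V) : inner ℝ (gram ι v) w = inner ℝ (ι v) (ι w) := by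
  simp [gram, ContinuousLinearMap.adjoint_inner_left]

theorem inner_gram' (v w : V) : inner ℝ v (gram ι w) = inner ℝ (ι v) (ι w) := by
  simp [gram, ContinuousLinearMap.adjoint_inner_right]

/-- `z : ℝ → V` is differentiable and satisfies `S z' = S z - z` with `S = ι* ι`. This is the strong
form of `(ι z', ι φ)_H + ((z, φ)_V - (ι z, ι φ)_H) = 0` for all `φ`; in the application the bracket is
the Dirichlet form. -/
def IsSmoothSolution (z : ℝ → V) : Prop :=
  ∃ z' : ℝ → V, ∀ t, HasDerivAt z (z' t) t ∧ gram ι (z' t) = gram ι (z t) - z t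

variable {ι}

/-- The dissipation inequalities behind the decay of `‖ι (z t)‖` and `‖z t‖`: pair the equation
with `v` and with `v'`. -/
theorem inner_nonpos_of_gram_eq (hι : ∀ v, ‖ι v‖ ≤ ‖v‖) {v v' : V}
    (h : gram ι v' = gram ι v - v) :
    inner ℝ (ι v) (ι v') ≤ 0 ∧ inner ℝ v v' ≤ 0 := by
  have hv : v = gram ι v - gram ι v' := by rw [h]; abel
  have h1 : inner ℝ v v = inner ℝ (ι v) (ι v) - inner ℝ (ι v') (ι v) := by
    conv_lhs => rw [hv, inner_sub_left, inner_gram, inner_gram]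
    rw [← hv]
  have h2 : inner ℝ v v' = inner ℝ (ι v) (ι v') - inner ℝ (ι v') (ι v') := by
    conv_lhs => rw [hv, inner_sub_left, inner_gram, inner_gram]
  have h3 := hι v
  rw [real_inner_self_eq_norm_sq, real_inner_self_eq_norm_sq] at h1
  rw [real_inner_self_eq_norm_sq] at h2
  have h4 : inner ℝ (ι v) (ι v') ≤ 0 := by
    rw [real_inner_comm]
    nlinarith [norm_nonneg (ι v), norm_nonneg v]
  exact ⟨h4, by nlinarith [sq_nonneg ‖ι v'‖]⟩

theorem IsSmoothSolution.norm_le (hι : ∀ v, ‖ι v‖ ≤ ‖v‖) {z : ℝ → V}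
    (hz : IsSmoothSolution ι z) {t : ℝ} (ht : 0 ≤ t) :
    ‖ι (z t)‖ ≤ ‖ι (z 0)‖ ∧ ‖z t‖ ≤ ‖z 0‖ := by
  obtain ⟨z', hz'⟩ := hz
  constructor
  · have hd : ∀ s, HasDerivAt (fun s => ‖ι (z s)‖ ^ 2) (2 * inner ℝ (ι (z s)) (ι (z' s))) s :=
      fun s => (ι.hasFDerivAt.comp_hasDerivAt s (hz' s).1).norm_sq
    have := antitone_of_hasDerivAt_nonpos hd fun s => by
      have := (inner_nonpos_of_gram_eq hι (hz' s).2).1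
      simp only [Pi.zero_apply]; linarith
    exact (sq_le_sq₀ (norm_nonneg _) (norm_nonneg _)).1 (this ht)
  · have hd : ∀ s, HasDerivAt (fun s => ‖z s‖ ^ 2) (2 * inner ℝ (z s) (z' s)) s :=
      fun s => (hz' s).1.norm_sq
    have := antitone_of_hasDerivAt_nonpos hd fun s => by
      have := (inner_nonpos_of_gram_eq hι (hz' s).2).2
      simp only [Pi.zero_apply]; linarith
    exact (sq_le_sq₀ (norm_nonneg _) (norm_nonneg _)).1 (this ht)

theorem IsSmoothSolution.integral_eq_zero {z : ℝ → V} (hz : IsSmoothSolution ι z) (T : ℝ)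
    {ψ : ℝ → ℝ} (hψ : ContDiff ℝ 1 ψ) (h0 : ψ 0 = 0) (hT : ψ T = 0) :
    ∫ t in 0..T, (deriv ψ t • gram ι (z t) + ψ t • (gram ι (z t) - z t)) = 0 := by
  obtain ⟨z', hz'⟩ := hz
  have hzc : Continuous z := continuous_iff_continuousAt.2 fun t => (hz' t).1.continuousAt
  have hψ' : Continuous (deriv ψ) := hψ.continuous_deriv le_rfl
  have hψc := hψ.continuous
  have hd : ∀ t, HasDerivAt (fun s => ψ s • gram ι (z s))
      (deriv ψ t • gram ι (z t) + ψ t • (gram ι (z t) - z t)) t := fun t => by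
    have h1 := ((hψ.differentiable one_ne_zero) t).hasDerivAt.smul
      ((gram ι).hasFDerivAt.comp_hasDerivAt t (hz' t).1)
    rw [(hz' t).2] at h1
    rw [add_comm]
    exact h1
  rw [intervalIntegral.integral_eq_sub_of_hasDerivAt (fun t _ => hd t)]
  · simp [h0, hT]
  · exact Continuous.intervalIntegrable (by fun_prop) _ _

variable (ι) in
/-- The restrictions to `[0, T]` of the differentiable solutions, in the space of continuous functions
with the uniform norm. -/
def smoothTrajectories (T : ℝ) : Submodule ℝ C(Icc 0 T, V) where
  carrier := {w | ∃ z : ℝ → V, IsSmoothSolution ι z ∧ ∀ t : Icc 0 T, w t = z t}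
  zero_mem' := ⟨fun _ => 0, ⟨fun _ => 0, fun t => ⟨hasDerivAt_const _ _, by simp⟩⟩, by simp⟩
  add_mem' := by
    rintro w₁ w₂ ⟨z₁, ⟨z₁', h₁⟩, hw₁⟩ ⟨z₂, ⟨z₂', h₂⟩, hw₂⟩
    refine ⟨z₁ + z₂, ⟨z₁' + z₂', fun t => ⟨(h₁ t).1.add (h₂ t).1, ?_⟩⟩, by simp [hw₁, hw₂]⟩
    simp only [Pi.add_apply, map_add, (h₁ t).2, (h₂ t).2]
    abel
  smul_mem' := by
    rintro c w ⟨z, ⟨z', h⟩, hw⟩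
    refine ⟨c • z, ⟨c • z', fun t => ⟨(h t).1.const_smul c, ?_⟩⟩, by simp [hw]⟩
    simp only [Pi.smul_apply, map_smul, (h t).2, smul_sub]

theorem norm_le_of_mem_closure (hι : ∀ v, ‖ι v‖ ≤ ‖v‖) {T : ℝ} (hT : 0 ≤ T) {w : C(Icc 0 T, V)}
    (hw : w ∈ (smoothTrajectories ι T).topologicalClosure) (t : Icc 0 T) :
    ‖ι (w t)‖ ≤ ‖ι (w ⟨0, left_mem_Icc.2 hT⟩)‖ ∧ ‖w t‖ ≤ ‖w ⟨0, left_mem_Icc.2 hT⟩‖ := by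
  let S : Set C(Icc 0 T, V) := {w | ‖ι (w t)‖ ≤ ‖ι (w ⟨0, left_mem_Icc.2 hT⟩)‖ ∧
    ‖w t‖ ≤ ‖w ⟨0, left_mem_Icc.2 hT⟩‖}
  have hS : IsClosed S := by
    refine IsClosed.and (isClosed_le ?_ ?_) (isClosed_le ?_ ?_) <;> fun_prop
  refine closure_minimal (t := S) ?_ hS hw
  rintro w ⟨z, hz, hwz⟩
  simp only [S, mem_ofPred_eq, hwz]
  exact hz.norm_le hι t.2.1

/-- Uniform limits of differentiable solutions satisfy the equation in the weak sense. The functions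
on `[0, T]` are extended by constants so that they can be integrated over `ℝ`. -/
theorem integral_eq_zero_of_mem_closure {T : ℝ} (hT : 0 ≤ T) {w : C(Icc 0 T, V)}
    (hw : w ∈ (smoothTrajectories ι T).topologicalClosure)
    {ψ : ℝ → ℝ} (hψ : ContDiff ℝ 1 ψ) (h0 : ψ 0 = 0) (hT0 : ψ T = 0) :
    ∫ t in 0..T, (deriv ψ t • gram ι (w (projIcc 0 T hT t)) +
      ψ t • (gram ι (w (projIcc 0 T hT t)) - w (projIcc 0 T hT t))) = 0 := by
  let S : Set C(Icc 0 T, V) := {w | ∫ t in 0..T, (deriv ψ t • gram ι (w (projIcc 0 T hT t)) +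
      ψ t • (gram ι (w (projIcc 0 T hT t)) - w (projIcc 0 T hT t))) = 0}
  have hψ' : Continuous (deriv ψ) := hψ.continuous_deriv le_rfl
  have hψc := hψ.continuous
  have hS : IsClosed S := by
    refine isClosed_eq ?_ continuous_const
    apply intervalIntegral.continuous_parametric_intervalIntegral_of_continuous'
    have hev : Continuous fun p : C(Icc 0 T, V) × ℝ => p.1 (projIcc 0 T hT p.2) :=
      continuous_eval.comp (continuous_fst.prodMk ((continuous_projIcc (h := hT)).comp continuous_snd))
    simp only [Function.uncurry_def]
    fun_prop
  refine closure_minimal (t := S) ?_ hS hw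
  rintro w ⟨z, hz, hwz⟩
  simp only [S, mem_ofPred_eq, hwz]
  rw [← hz.integral_eq_zero T hψ h0 hT0]
  refine intervalIntegral.integral_congr fun t ht => ?_
  rw [uIcc_of_le hT] at ht
  simp [projIcc_of_mem hT ht]

theorem isSmoothSolution_of_mem_eigenspace {μ : ℝ} (hμ : μ ≠ 0) {v : V}
    (hv : gram ι v = μ • v) :
    IsSmoothSolution ι fun t => Real.exp ((1 - μ⁻¹) * t) • v := by
  refine ⟨fun t => ((1 - μ⁻¹) * Real.exp ((1 - μ⁻¹) * t)) • v, fun t => ⟨?_, ?_⟩⟩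
  · have h : HasDerivAt (fun t => Real.exp ((1 - μ⁻¹) * t))
        ((1 - μ⁻¹) * Real.exp ((1 - μ⁻¹) * t)) t := by
      simpa [mul_comm] using ((hasDerivAt_id t).const_mul (1 - μ⁻¹)).exp
    exact h.smul_const v
  · simp only [map_smul, hv, smul_smul, ← sub_smul]
    rw [← sub_eq_zero, ← sub_smul]
    convert zero_smul ℝ v using 2
    field_simp
    ring

/-- Existence of a trajectory with prescribed `ι (w 0)`. The initial value `w 0` itself need not be
`g`: the component of `g` in the kernel of `ι` is dropped. -/
theorem exists_trajectory (hc : IsCompactOperator ι) (hι : ∀ v, ‖ι v‖ ≤ ‖v‖) {T : ℝ} (hT : 0 ≤ T)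
    (g : V) :
    ∃ w ∈ (smoothTrajectories ι T).topologicalClosure,
      ι (w ⟨0, left_mem_Icc.2 hT⟩) = ι g := by
  set o : Icc 0 T := ⟨0, left_mem_Icc.2 hT⟩
  let W := (smoothTrajectories ι T).topologicalClosure
  let ev : W →L[ℝ] V := (ContinuousMap.evalCLM ℝ o).comp W.subtypeL
  have hanti : AntilipschitzWith 1 ev := by
    refine AddMonoidHomClass.antilipschitz_of_bound ev fun w => ?_
    simp only [NNReal.coe_one, one_mul]
    exact (ContinuousMap.norm_le _ (norm_nonneg _)).2 fun t =>
      (norm_le_of_mem_closure hι hT w.2 t).2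
  -- A trajectory is controlled by its initial value, so the initial values form a closed subspace.
  have hWc : IsClosed (W : Set C(Icc 0 T, V)) := Submodule.isClosed_topologicalClosure _
  have : CompleteSpace W := hWc.completeSpace_coe
  have hclosed : IsClosed (ev.range : Set V) := hanti.isClosed_range ev.uniformContinuous
  have : CompleteSpace ev.range := hclosed.completeSpace_coe
  have heig : ∀ μ : ℝ, μ ≠ 0 → ∀ v, gram ι v = μ • v → v ∈ ev.range := fun μ hμ v hv =>
    ⟨⟨⟨fun t : Icc 0 T => Real.exp ((1 - μ⁻¹) * t) • v, by fun_prop⟩,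
      Submodule.le_topologicalClosure _
        ⟨_, isSmoothSolution_of_mem_eigenspace hμ hv, fun t => rfl⟩⟩, by simp [ev, o]⟩
  obtain ⟨a, ha, b, hb, hab⟩ := Submodule.exists_add_mem_mem_orthogonal (K := ev.range) g
  obtain ⟨w, rfl⟩ := ha
  have hsymm : ((gram ι : V →L[ℝ] V) : V →ₗ[ℝ] V).IsSymmetric := fun x y => by
    simp [inner_gram, inner_gram']
  have hcomp : IsCompactOperator (gram ι) :=
    hc.clm_comp (ContinuousLinearMap.adjoint ι)
  -- `S b` is orthogonal to the eigenspaces with `μ ≠ 0`, since `b` is, and to the kernel of `S`, since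
  -- `S` is symmetric. So it vanishes by the spectral theorem.
  have hbz : gram ι b ∈ (⨆ μ, Module.End.eigenspace (gram ι : Module.End ℝ V) μ)ᗮ := by
    rw [← Submodule.iInf_orthogonal, Submodule.mem_iInf]
    intro μ
    rw [Submodule.mem_orthogonal]
    intro v hv
    have hv' : gram ι v = μ • v := by simpa using Module.End.mem_eigenspace_iff.1 hv
    rw [inner_gram', ← inner_gram, hv', inner_smul_left]
    by_cases hμ : μ = 0
    · simp [hμ]
    · simp [Submodule.inner_right_of_mem_orthogonal (heig μ hμ v hv') hb]
  rw [ContinuousLinearMap.orthogonalComplement_iSup_eigenspaces_eq_bot hcomp hsymm,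
    Submodule.mem_bot] at hbz
  have hb0 : ι b = 0 := by
    rw [← inner_self_eq_zero (𝕜 := ℝ), ← inner_gram, hbz, inner_zero_left]
  refine ⟨w, w.2, ?_⟩
  rw [hab, map_add, hb0, add_zero]
  rfl

/-- The weak trajectory as a pair of `L₂(0,T)` functions, with the equation transported by an
operator `D`; the application takes for `D` the Riesz map into the dual space. -/
theorem exists_evolution {Y : Type*} [NormedAddCommGroup Y] [NormedSpace ℝ Y] [CompleteSpace Y]
    (hc : IsCompactOperator ι) (hι : ∀ v, ‖ι v‖ ≤ ‖v‖) {T : ℝ} (hT : 0 ≤ T) (g : V)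
    (D : V →L[ℝ] Y) :
    ∃ (z : Lp V 2 ((volume : Measure ℝ).restrict (Ioc 0 T)))
      (z' : Lp Y 2 ((volume : Measure ℝ).restrict (Ioc 0 T))) (zc : ℝ → V), Continuous zc ∧
      z =ᵐ[(volume : Measure ℝ).restrict (Ioc 0 T)] zc ∧
      (∀ᵐ t ∂((volume : Measure ℝ).restrict (Ioc 0 T)), z' t = D (gram ι (z t) - z t)) ∧
      (∀ ψ : ℝ → ℝ, ContDiff ℝ 1 ψ → ψ 0 = 0 → ψ T = 0 →
        ∫ t in Ioc 0 T, deriv ψ t • D (gram ι (z t)) = -∫ t in Ioc 0 T, ψ t • z' t) ∧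
      ι (zc 0) = ι g ∧ ∀ t, ‖ι (zc t)‖ ≤ ‖ι g‖ := by
  obtain ⟨w, hw, hw0⟩ := exists_trajectory hc hι hT g
  set zc : ℝ → V := fun t => w (projIcc 0 T hT t)
  have hzc : Continuous zc := w.continuous.comp continuous_projIcc
  have hz : MemLp zc 2 ((volume : Measure ℝ).restrict (Ioc 0 T)) :=
    MemLp.of_bound hzc.aestronglyMeasurable ‖w‖
      (Eventually.of_forall fun t => w.norm_coe_le_norm _)
  set A : V →L[ℝ] Y := D.comp (gram ι - ContinuousLinearMap.id ℝ V)
  have hA : ∀ v, A v = D (gram ι v - v) := fun v => rfl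
  have hz' : MemLp (fun t => A (zc t)) 2 ((volume : Measure ℝ).restrict (Ioc 0 T)) :=
    A.comp_memLp' hz
  refine ⟨hz.toLp zc, hz'.toLp _, zc, hzc, hz.coeFn_toLp, ?_, fun ψ hψ hψ0 hψT => ?_, ?_, ?_⟩
  · filter_upwards [hz.coeFn_toLp, hz'.coeFn_toLp] with t h1 h2
    rw [h1, h2, hA]
  · have hψc := hψ.continuous
    have hψ' : Continuous (deriv ψ) := hψ.continuous_deriv le_rfl
    have h := integral_eq_zero_of_mem_closure hT hw hψ hψ0 hψT
    rw [intervalIntegral.integral_of_le hT] at h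
    have h1 : ∫ t in Ioc 0 T, deriv ψ t • D (gram ι (hz.toLp zc t)) =
        ∫ t in Ioc 0 T, deriv ψ t • D (gram ι (zc t)) := by
      refine integral_congr_ae ?_
      filter_upwards [hz.coeFn_toLp] with t ht
      rw [ht]
    have h2 : ∫ t in Ioc 0 T, ψ t • (hz'.toLp (fun t => A (zc t))) t =
        ∫ t in Ioc 0 T, ψ t • A (zc t) := by
      refine integral_congr_ae ?_
      filter_upwards [hz'.coeFn_toLp] with t ht
      rw [ht]
    rw [h1, h2, ← add_eq_zero_iff_eq_neg]
    have h3 : Continuous fun t => deriv ψ t • D (gram ι (zc t)) := by fun_prop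
    have h4 : Continuous fun t => ψ t • A (zc t) := by fun_prop
    have h5 : Continuous fun t => deriv ψ t • gram ι (zc t) +
      ψ t • (gram ι (zc t) - zc t) := by fun_prop
    rw [← integral_add ((h3.continuousOn.integrableOn_compact isCompact_Icc).mono_set
        Ioc_subset_Icc_self) ((h4.continuousOn.integrableOn_compact isCompact_Icc).mono_set
        Ioc_subset_Icc_self), ← map_zero D, ← h, ← ContinuousLinearMap.integral_comp_comm]
    · simp [hA, zc]
    · exact (h5.continuousOn.integrableOn_compact isCompact_Icc).mono_set Ioc_subset_Icc_self
  · simpa [zc, projIcc_left] using hw0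
  · intro t
    rw [← hw0]
    exact (norm_le_of_mem_closure hι hT hw _).1

end Evolution

end Hilbert

/-! ### Rellich's theorem for `H¹₀(Ω)` -/

/-- Cauchy–Schwarz against the constant `1`. -/
theorem sq_lintegral_le {α : Type*} {m : MeasurableSpace α} (μ : Measure α) {f : α → ℝ≥0∞}
    (hf : AEMeasurable f μ) : (∫⁻ a, f a ∂μ) ^ 2 ≤ μ univ * ∫⁻ a, f a ^ 2 ∂μ := by
  have h := ENNReal.lintegral_mul_le_Lp_mul_Lq μ Real.HolderConjugate.two_two hf
    (aemeasurable_const (b := (1 : ℝ≥0∞)))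
  simp only [Pi.mul_apply, mul_one, ENNReal.rpow_ofNat, one_pow, lintegral_const, one_mul] at h
  calc (∫⁻ a, f a ∂μ) ^ 2
      ≤ ((∫⁻ a, f a ^ 2 ∂μ) ^ (1 / 2 : ℝ) * μ univ ^ (1 / 2 : ℝ)) ^ 2 := by gcongr
    _ = μ univ * ∫⁻ a, f a ^ 2 ∂μ := by
      rw [mul_pow, mul_comm, ← ENNReal.rpow_ofNat, ← ENNReal.rpow_ofNat, ← ENNReal.rpow_mul,
        ← ENNReal.rpow_mul]
      norm_num

theorem enorm_add_sq_le_young {F : Type*} [NormedAddCommGroup F] (a b : F) {δ : ℝ} (hδ : 0 < δ) :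
    ‖a + b‖ₑ ^ 2 ≤ ENNReal.ofReal (1 + δ) * ‖a‖ₑ ^ 2 + ENNReal.ofReal (1 + δ⁻¹) * ‖b‖ₑ ^ 2 := by
  have h : ‖a + b‖ ^ 2 ≤ (1 + δ) * ‖a‖ ^ 2 + (1 + δ⁻¹) * ‖b‖ ^ 2 := by
    have h1 : ‖a + b‖ ^ 2 ≤ (‖a‖ + ‖b‖) ^ 2 := by gcongr; exact norm_add_le a b
    have h2 : 0 ≤ δ⁻¹ * (δ * ‖a‖ - ‖b‖) ^ 2 := by positivity
    have h3 : δ⁻¹ * (δ * ‖a‖ - ‖b‖) ^ 2 = δ * ‖a‖ ^ 2 - 2 * ‖a‖ * ‖b‖ + δ⁻¹ * ‖b‖ ^ 2 := by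
      field_simp
      ring
    linarith
  simp only [← ofReal_norm]
  rw [← ENNReal.ofReal_pow (norm_nonneg _), ← ENNReal.ofReal_pow (norm_nonneg _),
    ← ENNReal.ofReal_pow (norm_nonneg _), ← ENNReal.ofReal_mul (by positivity),
    ← ENNReal.ofReal_mul (by positivity), ← ENNReal.ofReal_add (by positivity) (by positivity)]
  exact ENNReal.ofReal_le_ofReal h

theorem enorm_add_sq_le {F : Type*} [NormedAddCommGroup F] (a b : F) :
    ‖a + b‖ₑ ^ 2 ≤ 2 * ‖a‖ₑ ^ 2 + 2 * ‖b‖ₑ ^ 2 := by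
  simpa [one_add_one_eq_two] using enorm_add_sq_le_young a b one_pos

/-- Translating by `h` changes a function by at most `‖h‖ ‖∇φ‖` in `L₂`: integrate the gradient along
the segment from `x` to `x + h`. -/
theorem lintegral_enorm_translate_sub_sq_le {d : ℕ} {φ : E d → ℝ} (hφ : ContDiff ℝ 1 φ) (h : E d) :
    ∫⁻ x, ‖φ x - φ (x + h)‖ₑ ^ 2 ≤ ‖h‖ₑ ^ 2 * ∫⁻ x, ‖∇ φ x‖ₑ ^ 2 := by
  have hφ' : Continuous (fderiv ℝ φ) := hφ.continuous_fderiv one_ne_zero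
  have hgrad : ∀ x, ‖∇ φ x‖ₑ = ‖fderiv ℝ φ x‖ₑ := fun x => by
    simp [gradient, ← ofReal_norm]
  have hpt : ∀ x, ‖φ x - φ (x + h)‖ₑ ^ 2 ≤
      ∫⁻ s in Ioc (0 : ℝ) 1, ‖h‖ₑ ^ 2 * ‖∇ φ (x + s • h)‖ₑ ^ 2 := by
    intro x
    have hd : ∀ s : ℝ, HasDerivAt (fun s : ℝ => φ (x + s • h)) (fderiv ℝ φ (x + s • h) h) s := by
      intro s
      have h1 : HasDerivAt (fun s : ℝ => x + s • h) h s := by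
        simpa using ((hasDerivAt_id s).smul_const h).const_add x
      exact ((hφ.differentiable one_ne_zero) (x + s • h)).hasFDerivAt.comp_hasDerivAt s h1
    have hc : Continuous fun s : ℝ => fderiv ℝ φ (x + s • h) h := by fun_prop
    have hint : φ (x + h) - φ x = ∫ s in Ioc (0 : ℝ) 1, fderiv ℝ φ (x + s • h) h := by
      rw [← intervalIntegral.integral_of_le zero_le_one,
        intervalIntegral.integral_eq_sub_of_hasDerivAt (fun s _ => hd s)
          (hc.intervalIntegrable _ _)]
      simp
    rw [← enorm_neg, neg_sub, hint]
    calc _ ≤ (∫⁻ s in Ioc (0 : ℝ) 1, ‖fderiv ℝ φ (x + s • h) h‖ₑ) ^ 2 := by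
          gcongr; exact enorm_integral_le_lintegral_enorm _
      _ ≤ ∫⁻ s in Ioc (0 : ℝ) 1, ‖fderiv ℝ φ (x + s • h) h‖ₑ ^ 2 := by
          simpa using sq_lintegral_le (volume.restrict (Ioc (0 : ℝ) 1)) hc.enorm.aemeasurable
      _ ≤ _ := by
          refine lintegral_mono fun s => ?_
          rw [← mul_pow, hgrad, mul_comm]
          gcongr
          exact ContinuousLinearMap.le_opENorm _ _
  have hgc : Continuous (∇ φ) :=
    (InnerProductSpace.toDual ℝ (E d)).symm.continuous.comp hφ'
  calc _ ≤ ∫⁻ x, ∫⁻ s in Ioc (0 : ℝ) 1, ‖h‖ₑ ^ 2 * ‖∇ φ (x + s • h)‖ₑ ^ 2 := lintegral_mono hpt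
    _ = ∫⁻ s in Ioc (0 : ℝ) 1, ∫⁻ x, ‖h‖ₑ ^ 2 * ‖∇ φ (x + s • h)‖ₑ ^ 2 := by
      refine lintegral_lintegral_swap (Measurable.aemeasurable ?_)
      simp only [Function.uncurry_def]
      have : Continuous fun p : E d × ℝ => ∇ φ (p.1 + p.2 • h) := by fun_prop
      exact (this.enorm.measurable.pow_const 2).const_mul _
    _ = ∫⁻ s in Ioc (0 : ℝ) 1, ‖h‖ₑ ^ 2 * ∫⁻ x, ‖∇ φ x‖ₑ ^ 2 := by
      refine lintegral_congr fun s => ?_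
      have hs : Continuous fun x => ∇ φ (x + s • h) := by fun_prop
      rw [lintegral_const_mul _ (hs.enorm.measurable.pow_const 2),
        lintegral_add_right_eq_self (fun x => ‖∇ φ x‖ₑ ^ 2)]
    _ = _ := by simp

/-- The `L₂` norm of `φ` is controlled by its gradient, with a small factor, and its averages over
balls of radius `ε`. -/
theorem lintegral_enorm_sq_le_average {d : ℕ} {φ : E d → ℝ} (hφ : ContDiff ℝ 1 φ) (S : Set (E d))
    {ε : ℝ} (hε : 0 < ε) :
    ∫⁻ x in S, ‖φ x‖ₑ ^ 2 ≤ 2 * ENNReal.ofReal ε ^ 2 * (∫⁻ x, ‖∇ φ x‖ₑ ^ 2) +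
      2 * ((volume (Metric.ball (0 : E d) ε))⁻¹ ^ 2 *
        ∫⁻ x in S, ‖∫ h in Metric.ball 0 ε, φ (x + h)‖ₑ ^ 2) := by
  set B : Set (E d) := Metric.ball 0 ε
  have hB0 : volume B ≠ 0 := (Metric.measure_ball_pos _ _ hε).ne'
  have hBt : volume B ≠ ⊤ := measure_ball_lt_top.ne
  have hφc := hφ.continuous
  have hint : ∀ x, IntegrableOn (fun h => φ (x + h)) B := fun x =>
    ((Continuous.continuousOn (by fun_prop)).integrableOn_compact
      (isCompact_closedBall (0 : E d) ε)).mono_set Metric.ball_subset_closedBall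
  have hpt : ∀ x, volume B ^ 2 * ‖φ x‖ₑ ^ 2 ≤ 2 * (volume B * ∫⁻ h in B, ‖φ x - φ (x + h)‖ₑ ^ 2) +
      2 * ‖∫ h in B, φ (x + h)‖ₑ ^ 2 := by
    intro x
    have h1 : (volume.real B) • φ x = (∫ h in B, (φ x - φ (x + h))) + ∫ h in B, φ (x + h) := by
      rw [integral_sub (integrableOn_const (C := φ x) hBt) (hint x)]
      simp
    have h2 : volume B ^ 2 * ‖φ x‖ₑ ^ 2 = ‖(volume.real B) • φ x‖ₑ ^ 2 := by
      rw [enorm_smul, mul_pow, Real.enorm_of_nonneg measureReal_nonneg, measureReal_def,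
        ENNReal.ofReal_toReal hBt]
    rw [h2, h1]
    refine (enorm_add_sq_le _ _).trans ?_
    gcongr
    calc _ ≤ (∫⁻ h in B, ‖φ x - φ (x + h)‖ₑ) ^ 2 := by
          gcongr; exact enorm_integral_le_lintegral_enorm _
      _ ≤ _ := by
          simpa using sq_lintegral_le (volume.restrict B) (f := fun h => ‖φ x - φ (x + h)‖ₑ)
            (Continuous.aemeasurable (by fun_prop))
  have hm : Measurable fun p : E d × E d => ‖φ p.1 - φ (p.1 + p.2)‖ₑ ^ 2 := by
    have : Continuous fun p : E d × E d => φ p.1 - φ (p.1 + p.2) := by fun_prop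
    exact this.enorm.measurable.pow_const 2
  have hI : volume B ^ 2 * ∫⁻ x in S, ‖φ x‖ₑ ^ 2 ≤
      2 * (volume B * (volume B * (ENNReal.ofReal ε ^ 2 * ∫⁻ x, ‖∇ φ x‖ₑ ^ 2))) +
        2 * ∫⁻ x in S, ‖∫ h in B, φ (x + h)‖ₑ ^ 2 := by
    rw [← lintegral_const_mul _ (by fun_prop)]
    refine (lintegral_mono hpt).trans ?_
    rw [lintegral_add_left ((hm.lintegral_prod_right'.const_mul _).const_mul _),
      lintegral_const_mul _ (hm.lintegral_prod_right'.const_mul _),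
      lintegral_const_mul _ hm.lintegral_prod_right', lintegral_const_mul' _ _ (by simp)]
    gcongr
    calc _ ≤ ∫⁻ x, ∫⁻ h in B, ‖φ x - φ (x + h)‖ₑ ^ 2 := setLIntegral_le_lintegral _ _
      _ = ∫⁻ h in B, ∫⁻ x, ‖φ x - φ (x + h)‖ₑ ^ 2 := lintegral_lintegral_swap hm.aemeasurable
      _ ≤ ∫⁻ h in B, ENNReal.ofReal ε ^ 2 * ∫⁻ x, ‖∇ φ x‖ₑ ^ 2 := by
        refine setLIntegral_mono measurable_const fun h hh => ?_
        refine (lintegral_enorm_translate_sub_sq_le hφ h).trans ?_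
        gcongr
        rw [← ofReal_norm]
        exact ENNReal.ofReal_le_ofReal (mem_ball_zero_iff.1 hh).le
      _ = _ := by rw [setLIntegral_const, mul_comm]
  have hB2 : (volume B)⁻¹ ^ 2 * volume B ^ 2 = 1 := by
    rw [← mul_pow, ENNReal.inv_mul_cancel hB0 hBt, one_pow]
  calc _ = (volume B)⁻¹ ^ 2 * (volume B ^ 2 * ∫⁻ x in S, ‖φ x‖ₑ ^ 2) := by
        rw [← mul_assoc, hB2, one_mul]
    _ ≤ _ := mul_le_mul' le_rfl hI
    _ = ((volume B)⁻¹ ^ 2 * volume B ^ 2) * (2 * ENNReal.ofReal ε ^ 2 * (∫⁻ x, ‖∇ φ x‖ₑ ^ 2)) +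
      2 * ((volume B)⁻¹ ^ 2 *
        ∫⁻ x in S, ‖∫ h in B, φ (x + h)‖ₑ ^ 2) := by ring
    _ = _ := by rw [hB2, one_mul]

theorem norm_sq_eq {d : ℕ} {Ω : Opens (E d)} (f : H10 Ω) :
    ‖f‖ ^ 2 = ‖toL2 Ω f‖ ^ 2 + ‖grad Ω f‖ ^ 2 :=
  WithLp.prod_norm_sq_eq_of_L2 (f : Ambient Ω)

theorem inner_eq {d : ℕ} {Ω : Opens (E d)} (f g : H10 Ω) :
    inner ℝ f g = inner ℝ (toL2 Ω f) (toL2 Ω g) + inner ℝ (grad Ω f) (grad Ω g) :=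
  WithLp.prod_inner_apply (f : Ambient Ω) (g : Ambient Ω)

theorem norm_toL2_le {d : ℕ} {Ω : Opens (E d)} (f : H10 Ω) : ‖toL2 Ω f‖ ≤ ‖f‖ := by
  have := norm_sq_eq f
  exact (sq_le_sq₀ (norm_nonneg _) (norm_nonneg _)).1 (by nlinarith [sq_nonneg ‖grad Ω f‖])

theorem norm_grad_le {d : ℕ} {Ω : Opens (E d)} (f : H10 Ω) : ‖grad Ω f‖ ≤ ‖f‖ := by
  have := norm_sq_eq f
  exact (sq_le_sq₀ (norm_nonneg _) (norm_nonneg _)).1 (by nlinarith [sq_nonneg ‖toL2 Ω f‖])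

theorem enorm_Lp_two_sq {α F : Type*} {m : MeasurableSpace α} {μ : Measure α}
    [NormedAddCommGroup F] (f : Lp F 2 μ) : ‖f‖ₑ ^ 2 = ∫⁻ x, ‖f x‖ₑ ^ 2 ∂μ := by
  rw [Lp.enorm_def, ← ENNReal.rpow_ofNat, eLpNorm_eq_lintegral_rpow_enorm_toReal (by simp) (by simp),
    ← ENNReal.rpow_mul]
  simp

/-- Rellich's theorem for sequences of test functions; `tendsto_toL2_of_tendsto_inner` reduces the
general case to this one by density. -/
theorem tendsto_toL2_of_test {d : ℕ} {Ω : Opens (E d)} (hΩ : Bornology.IsBounded (Ω : Set (E d)))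
    {p : ℕ → H10 Ω} {r : ℝ} (hp : ∀ n, (p n : Ambient Ω) ∈ testPairs Ω) (hr : ∀ n, ‖p n‖ ≤ r)
    (hw : ∀ v, Tendsto (fun n => inner ℝ (toL2 Ω (p n)) v) atTop (𝓝 0)) :
    Tendsto (fun n => toL2 Ω (p n)) atTop (𝓝 0) := by
  choose φ hφ1 hφ2 using hp
  replace hφ1 : ∀ n, (toL2 Ω (p n) : E d → ℝ) =ᵐ[volume.restrict (Ω : Set (E d))] φ n := hφ1
  replace hφ2 : ∀ n, (grad Ω (p n) : E d → E d) =ᵐ[volume.restrict (Ω : Set (E d))]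
    ∇ (φ n : E d → ℝ) := hφ2
  have hΩm : MeasurableSet (Ω : Set (E d)) := Ω.isOpen.measurableSet
  have hΩt : volume (Ω : Set (E d)) < ⊤ := hΩ.measure_lt_top
  have hsmooth : ∀ n, ContDiff ℝ 1 (φ n : E d → ℝ) := fun n => (φ n).contDiff.of_le (by simp)
  have hcont : ∀ n, Continuous (φ n : E d → ℝ) := fun n => (hsmooth n).continuous
  have hz : ∀ n, ∀ x ∉ (Ω : Set (E d)), φ n x = 0 := fun n x hx =>
    image_eq_zero_of_notMem_tsupport fun h => hx ((φ n).tsupport_subset h)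
  have hz' : ∀ n, ∀ x ∉ (Ω : Set (E d)), ∇ (φ n : E d → ℝ) x = 0 := fun n x hx => by
    have : fderiv ℝ (φ n : E d → ℝ) x = 0 := image_eq_zero_of_notMem_tsupport fun h =>
      hx ((φ n).tsupport_subset (tsupport_fderiv_subset ℝ h))
    simp [gradient, this]
  have hL2 : ∀ n, ∫⁻ x in (Ω : Set (E d)), ‖φ n x‖ₑ ^ 2 = ‖toL2 Ω (p n)‖ₑ ^ 2 := fun n => by
    rw [enorm_Lp_two_sq]
    refine lintegral_congr_ae ?_
    filter_upwards [hφ1 n] with x hx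
    rw [hx]
  have hL2' : ∀ n, ∫⁻ x, ‖φ n x‖ₑ ^ 2 ≤ ENNReal.ofReal r ^ 2 := fun n => by
    rw [← setLIntegral_eq_of_support_subset (s := (Ω : Set (E d))), hL2, ← ofReal_norm]
    · exact pow_le_pow_left' (ENNReal.ofReal_le_ofReal ((norm_toL2_le _).trans (hr n))) 2
    · intro x hx
      by_contra h
      simp [hz n x h] at hx
  have hG : ∀ n, ∫⁻ x, ‖∇ (φ n : E d → ℝ) x‖ₑ ^ 2 ≤ ENNReal.ofReal r ^ 2 := fun n => by
    rw [← setLIntegral_eq_of_support_subset (s := (Ω : Set (E d)))]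
    · calc _ = ‖grad Ω (p n)‖ₑ ^ 2 := by
            rw [enorm_Lp_two_sq]
            refine lintegral_congr_ae ?_
            filter_upwards [hφ2 n] with x hx
            rw [hx]
        _ ≤ _ := by
            rw [← ofReal_norm]
            exact pow_le_pow_left' (ENNReal.ofReal_le_ofReal ((norm_grad_le _).trans (hr n))) 2
    · intro x hx
      by_contra h
      simp [hz' n x h] at hx
  have havg : ∀ ε : ℝ, Tendsto (fun n => ∫⁻ x in (Ω : Set (E d)),
      ‖∫ h in Metric.ball 0 ε, φ n (x + h)‖ₑ ^ 2) atTop (𝓝 0) := by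
    intro ε
    have hBt : volume (Metric.ball (0 : E d) ε) ≠ ⊤ := measure_ball_lt_top.ne
    have := tendsto_lintegral_of_dominated_convergence (μ := volume.restrict (Ω : Set (E d)))
      (F := fun n x => ‖∫ h in Metric.ball 0 ε, φ n (x + h)‖ₑ ^ 2) (f := fun _ => 0)
      (fun _ => volume (Metric.ball (0 : E d) ε) * ENNReal.ofReal r ^ 2) ?_ ?_ ?_ ?_
    · simpa using this
    · intro n
      have hc : Continuous fun q : E d × E d => φ n (q.1 + q.2) := by
        have := hcont n
        fun_prop
      exact (hc.stronglyMeasurable.integral_prod_right').enorm.pow_const 2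
    · refine fun n => Eventually.of_forall fun x => ?_
      calc _ ≤ (∫⁻ h in Metric.ball 0 ε, ‖φ n (x + h)‖ₑ) ^ 2 :=
            pow_le_pow_left' (enorm_integral_le_lintegral_enorm _) 2
        _ ≤ volume (Metric.ball (0 : E d) ε) * ∫⁻ h in Metric.ball 0 ε, ‖φ n (x + h)‖ₑ ^ 2 := by
            have := hcont n
            simpa using sq_lintegral_le (volume.restrict (Metric.ball (0 : E d) ε))
              (f := fun h => ‖φ n (x + h)‖ₑ) (Continuous.aemeasurable (by fun_prop))
        _ ≤ _ := by
            refine mul_le_mul' le_rfl ((setLIntegral_le_lintegral _ _).trans ?_)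
            rw [lintegral_add_left_eq_self (fun h => ‖φ n h‖ₑ ^ 2)]
            exact hL2' n
    · rw [lintegral_const]
      exact ENNReal.mul_ne_top (ENNReal.mul_ne_top hBt (by simp)) (by simpa using hΩt.ne)
    · refine Eventually.of_forall fun x => ?_
      have hBx : MeasurableSet (Metric.ball x ε) := measurableSet_ball
      have hfin : (volume.restrict (Ω : Set (E d))) (Metric.ball x ε) ≠ ⊤ :=
        ((Measure.restrict_apply_le _ _).trans_lt measure_ball_lt_top).ne
      -- The average over `ball x ε` is the `L₂(Ω)` pairing with the indicator function of that ball.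
      have key : ∀ n, ∫ h in Metric.ball 0 ε, φ n (x + h) =
          inner ℝ (toL2 Ω (p n)) (indicatorConstLp 2 hBx hfin (1 : ℝ)) := by
        intro n
        rw [real_inner_comm, L2.inner_indicatorConstLp_one, setIntegral_congr_ae hBx
          ((hφ1 n).mono fun y hy _ => hy), Measure.restrict_restrict hBx,
          ← integral_indicator (hBx.inter hΩm), ← integral_indicator measurableSet_ball,
          ← integral_add_left_eq_self ((Metric.ball x ε ∩ (Ω : Set (E d))).indicator (φ n)) x]
        refine integral_congr_ae (Eventually.of_forall fun h => ?_)
        by_cases h1 : h ∈ Metric.ball (0 : E d) ε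
        · have h2 : x + h ∈ Metric.ball x ε := by simpa using h1
          by_cases h3 : x + h ∈ (Ω : Set (E d))
          · simp [indicator, h1, h2, h3]
          · simp [indicator, h3, hz n _ h3]
        · have h2 : x + h ∉ Metric.ball x ε := by simpa using h1
          simp [indicator, h1, h2]
      simp only [key]
      have h3 := ENNReal.Tendsto.pow (n := 2) (hw (indicatorConstLp 2 hBx hfin (1 : ℝ))).enorm
      simpa using h3
  have hmain : Tendsto (fun n => ‖toL2 Ω (p n)‖ₑ ^ 2) atTop (𝓝 0) := by
    rw [ENNReal.tendsto_nhds_zero]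
    intro δ hδ
    obtain ⟨ε, hε, hεδ⟩ : ∃ ε : ℝ, 0 < ε ∧
        2 * ENNReal.ofReal ε ^ 2 * ENNReal.ofReal r ^ 2 ≤ δ / 2 := by
      have hc : Continuous fun ε : ℝ => 2 * ENNReal.ofReal ε ^ 2 * ENNReal.ofReal r ^ 2 := by
        refine ENNReal.continuous_mul_const (by simp) |>.comp ?_
        refine ENNReal.continuous_const_mul (by simp) |>.comp ?_
        exact (ENNReal.continuous_pow 2).comp ENNReal.continuous_ofReal
      have h0 : Tendsto (fun ε : ℝ => 2 * ENNReal.ofReal ε ^ 2 * ENNReal.ofReal r ^ 2)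
          (𝓝[>] 0) (𝓝 0) := by
        simpa using (hc.tendsto 0).mono_left nhdsWithin_le_nhds
      obtain ⟨ε, h1, h2⟩ := ((h0.eventually_le_const (ENNReal.half_pos hδ.ne')).and
        self_mem_nhdsWithin).exists
      exact ⟨ε, h2, h1⟩
    have h1 : Tendsto (fun n => 2 * ((volume (Metric.ball (0 : E d) ε))⁻¹ ^ 2 *
        ∫⁻ x in (Ω : Set (E d)), ‖∫ h in Metric.ball 0 ε, φ n (x + h)‖ₑ ^ 2)) atTop (𝓝 0) := by
      have hB0 : volume (Metric.ball (0 : E d) ε) ≠ 0 := (Metric.measure_ball_pos _ _ hε).ne'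
      have := ENNReal.Tendsto.const_mul (a := 2)
        (ENNReal.Tendsto.const_mul (a := (volume (Metric.ball (0 : E d) ε))⁻¹ ^ 2) (havg ε)
          (Or.inr (ENNReal.pow_ne_top (by simpa using hB0)))) (Or.inr (by simp))
      simpa using this
    filter_upwards [h1.eventually_le_const (ENNReal.half_pos hδ.ne')] with n hn
    rw [← hL2, ← ENNReal.add_halves δ]
    refine (lintegral_enorm_sq_le_average (hsmooth n) _ hε).trans (add_le_add ?_ hn)
    exact le_trans (by gcongr; exact hG n) hεδ
  rw [tendsto_zero_iff_norm_tendsto_zero]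
  have h2 := (ENNReal.tendsto_toReal (by simp)).comp hmain
  have h3 := (Real.continuous_sqrt.tendsto _).comp h2
  simpa [Function.comp_def] using h3

instance separableSpace_H10 {d : ℕ} (Ω : Opens (E d)) : SeparableSpace (H10 Ω) := by
  have : Fact (1 ≤ (2 : ℝ≥0∞)) := ⟨one_le_two⟩
  have : Fact ((2 : ℝ≥0∞) ≠ ⊤) := ⟨ENNReal.ofNat_ne_top⟩
  have h1 : SecondCountableTopology (L2 Ω) := Lp.SecondCountableTopology
  have h2 : SecondCountableTopology (L2Vec Ω) := Lp.SecondCountableTopology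
  have h3 : SecondCountableTopology (Ambient Ω) := WithLp.secondCountableTopology 2 _ _
  have h4 : SecondCountableTopology (H10 Ω) := Subtype.secondCountableTopology _
  infer_instance

/-- Weakly null sequences in `H¹₀(Ω)` are norm null in `L₂(Ω)`. -/
theorem tendsto_toL2_of_tendsto_inner {d : ℕ} {Ω : Opens (E d)}
    (hΩ : Bornology.IsBounded (Ω : Set (E d))) {x : ℕ → H10 Ω} {r : ℝ} (hx : ∀ n, ‖x n‖ ≤ r)
    (hw : ∀ v, Tendsto (fun n => inner ℝ (x n) v) atTop (𝓝 0)) :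
    Tendsto (fun n => toL2 Ω (x n)) atTop (𝓝 0) := by
  have happ : ∀ n : ℕ, ∃ p : H10 Ω, (p : Ambient Ω) ∈ testPairs Ω ∧ ‖x n - p‖ ≤ 1 / (n + 1 : ℝ) := by
    intro n
    have h := (x n).2
    rw [← SetLike.mem_coe, Submodule.topologicalClosure_coe, Metric.mem_closure_iff] at h
    obtain ⟨p, hp, hd⟩ := h (1 / (n + 1 : ℝ)) (by positivity)
    refine ⟨⟨p, Submodule.le_topologicalClosure _ hp⟩, hp, ?_⟩
    rw [dist_eq_norm] at hd
    exact hd.le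
  -- Test functions approximating `x n` with error at most `1 / (n + 1)` are still weakly null.
  choose p hp hxp using happ
  have hlim : Tendsto (fun n => x n - p n) atTop (𝓝 0) :=
    squeeze_zero_norm hxp tendsto_one_div_add_atTop_nhds_zero_nat
  have hpw : ∀ v, Tendsto (fun n => inner ℝ (p n) v) atTop (𝓝 0) := fun v => by
    have h := (hw v).sub (hlim.inner (tendsto_const_nhds (x := v)))
    simpa only [← inner_sub_left, sub_sub_cancel, inner_zero_left, sub_zero] using h
  have h1 := tendsto_toL2_of_test hΩ (r := r + 1) hp (fun n => ?_) (fun v => ?_)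
  · have h2 := ((toL2 Ω).continuous.tendsto 0).comp hlim
    have h3 := h2.add h1
    simpa [Function.comp_def] using h3
  · have h2 : (1 : ℝ) / (n + 1) ≤ 1 := by
      rw [div_le_one (by positivity)]; linarith [n.cast_nonneg (α := ℝ)]
    calc ‖p n‖ = ‖x n - (x n - p n)‖ := by congr 1; abel
      _ ≤ ‖x n‖ + ‖x n - p n‖ := norm_sub_le _ _
      _ ≤ r + 1 := add_le_add (hx n) ((hxp n).trans h2)
  · simpa [ContinuousLinearMap.adjoint_inner_right] using
      hpw (ContinuousLinearMap.adjoint (toL2 Ω) v)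

theorem isCompactOperator_toL2 {d : ℕ} {Ω : Opens (E d)}
    (hΩ : Bornology.IsBounded (Ω : Set (E d))) : IsCompactOperator (toL2 Ω) :=
  isCompactOperator_of_tendsto_zero _ fun _ _ hx hw => tendsto_toL2_of_tendsto_inner hΩ hx hw

/-! ### Weak solutions of the heat equation -/

variable {d : ℕ} {Ω : Opens (E d)} {T : ℝ} {ω : Set (E d)}

/-- The Riesz map `H¹₀(Ω) → H⁻¹(Ω)`, `v ↦ (φ ↦ (v, φ)_{H¹})`, as an `ℝ`-linear map. -/
noncomputable def riesz (Ω : Opens (E d)) : H10 Ω →L[ℝ] Hneg1 Ω :=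
  LinearMap.mkContinuous
    { toFun := fun v => innerSL ℝ v
      map_add' := fun v w => by ext; simp
      map_smul' := fun c v => by ext; simp } 1 fun v => by simp

theorem riesz_apply (v φ : H10 Ω) : riesz Ω v φ = inner ℝ v φ := rfl

theorem toHneg1_toL2 (v : H10 Ω) : toHneg1 Ω (toL2 Ω v) = riesz Ω (gram (toL2 Ω) v) := by
  ext φ
  rw [riesz_apply, inner_gram]
  rfl

theorem ae_integral_control_zero (ω : Set (E d)) :
    ∀ᵐ t ∂((volume : Measure ℝ).restrict (Ioc 0 T)), ∀ φ : H10 Ω,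
      ∫ x in (Ω : Set (E d)), ω.indicator ((0 : L2Time T (L2 Ω)) t) x * toL2 Ω φ x = 0 := by
  filter_upwards [Lp.coeFn_zero (L2 Ω) 2 ((volume : Measure ℝ).restrict (Ioc 0 T))] with t ht φ
  rw [ht]
  refine integral_eq_zero_of_ae ?_
  filter_upwards [Lp.coeFn_zero ℝ 2 ((volume : Measure (E d)).restrict (Ω : Set (E d)))] with x hx
  by_cases h : x ∈ ω <;> simp_all

/-- The homogeneous heat equation is solvable, and the `L₂(Ω)` norm of the solution stays below that
of the initial value. -/
theorem exists_isWeakSolution_zero (hΩ : Bornology.IsBounded (Ω : Set (E d))) (hT : 0 < T)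
    (ω : Set (E d)) (g : H10 Ω) :
    ∃ z : L2Time T (H10 Ω), IsWeakSolution Ω T ω 0 g z ∧
      ∀ᵐ t ∂((volume : Measure ℝ).restrict (Ioc 0 T)), ‖toL2 Ω (z t)‖ ≤ ‖toL2 Ω g‖ := by
  obtain ⟨z, z', zc, hzc, hz, hz', hdual, h0, hle⟩ := exists_evolution (V := H10 Ω) (Y := Hneg1 Ω)
    (isCompactOperator_toL2 hΩ) norm_toL2_le hT.le g (riesz Ω)
  refine ⟨z, ⟨⟨z', fun ψ => ?_, ?_⟩, fun t => toL2 Ω (zc t), ?_, ?_, h0⟩, ?_⟩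
  · have hψ0 : ∀ t ∉ Ioo 0 T, ψ t = 0 := fun t ht =>
      image_eq_zero_of_notMem_tsupport fun h => ht (ψ.tsupport_subset h)
    simp only [toHneg1_toL2]
    exact hdual ψ (ψ.contDiff.of_le (by simp)) (hψ0 0 (by simp)) (hψ0 T (by simp))
  · filter_upwards [hz', ae_integral_control_zero (Ω := Ω) ω] with t h2 h3 φ
    rw [h2, h3, riesz_apply, inner_sub_left, inner_gram, inner_eq (z t) φ]
    ring
  · exact ((toL2 Ω).continuous.comp hzc).continuousOn
  · filter_upwards [hz] with t h1
    rw [h1]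
  · filter_upwards [hz] with t h1
    rw [h1]
    exact hle t

theorem integral_smul_clm_add {α X Y : Type*} {m : MeasurableSpace α} {μ : Measure α}
    [IsFiniteMeasure μ] [NormedAddCommGroup X] [NormedSpace ℝ X] [NormedAddCommGroup Y]
    [NormedSpace ℝ Y] (L : X →L[ℝ] Y) {θ : α → ℝ} (hθ : MemLp θ ⊤ μ) (y z : Lp X 2 μ) :
    ∫ t, θ t • L ((y + z) t) ∂μ = ∫ t, θ t • L (y t) ∂μ + ∫ t, θ t • L (z t) ∂μ := by
  have h : ∀ y : Lp X 2 μ, Integrable (fun t => θ t • L (y t)) μ := fun y =>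
    (L.integrable_comp ((Lp.memLp y).integrable one_le_two)).smul_of_top_right hθ
  rw [← integral_add (h y) (h z)]
  refine integral_congr_ae ?_
  filter_upwards [Lp.coeFn_add y z] with t ht
  simp only [ht, Pi.add_apply, map_add, smul_add]

theorem IsWeakTimeDeriv.add {y z : L2Time T (H10 Ω)} {y' z' : L2Time T (Hneg1 Ω)}
    (hy : IsWeakTimeDeriv Ω T y y') (hz : IsWeakTimeDeriv Ω T z z') :
    IsWeakTimeDeriv Ω T (y + z) (y' + z') := by
  intro ψ
  have hψ : MemLp (ψ : ℝ → ℝ) ⊤ (volume.restrict (Ioc 0 T)) :=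
    ψ.continuous.memLp_top_of_hasCompactSupport ψ.hasCompactSupport _
  have hψ' : MemLp (deriv (ψ : ℝ → ℝ)) ⊤ (volume.restrict (Ioc 0 T)) :=
    (ψ.contDiff.continuous_deriv (by simp)).memLp_top_of_hasCompactSupport
      ψ.hasCompactSupport.deriv _
  have hy1 := hy ψ
  have hz1 := hz ψ
  have h1 := integral_smul_clm_add (X := H10 Ω) (Y := Hneg1 Ω)
    ((riesz Ω).comp (gram (toL2 Ω))) hψ' y z
  have h2 := integral_smul_clm_add (X := Hneg1 Ω) (Y := Hneg1 Ω)
    (ContinuousLinearMap.id ℝ _) hψ y' z'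
  simp only [toHneg1_toL2] at hy1 hz1 ⊢
  refine h1.trans ((congrArg₂ (· + ·) hy1 hz1).trans ?_)
  rw [← neg_add]
  exact congrArg Neg.neg h2.symm

theorem IsWeakSolution.add_zero_control {u : L2Time T (L2 Ω)} {f g : H10 Ω}
    {y z : L2Time T (H10 Ω)} (hy : IsWeakSolution Ω T ω u f y)
    (hz : IsWeakSolution Ω T ω 0 g z) : IsWeakSolution Ω T ω u (f + g) (y + z) := by
  obtain ⟨⟨y', hyd, hye⟩, yc, hyc, hya, hy0⟩ := hy
  obtain ⟨⟨z', hzd, hze⟩, zc, hzc, hza, hz0⟩ := hz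
  refine ⟨⟨y' + z', hyd.add hzd, ?_⟩, yc + zc, hyc.add hzc, ?_, by simp [hy0, hz0]⟩
  · filter_upwards [hye, hze, Lp.coeFn_add y z, Lp.coeFn_add y' z',
      ae_integral_control_zero (Ω := Ω) ω] with t h1 h2 h3 h4 h5 φ
    rw [h3, h4, ← h1 φ]
    have h6 := h2 φ
    rw [h5 φ] at h6
    simp only [Pi.add_apply, map_add, _root_.add_apply, inner_add_left]
    linarith
  · filter_upwards [hya, hza, Lp.coeFn_add y z] with t h1 h2 h3
    rw [h3, Pi.add_apply, Pi.add_apply, h1, h2, map_add]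

/-! ### Semicontinuity of the cost and the maximizer -/

/-- The cost of the control `u = 0`. -/
theorem J1_le (hΩ : Bornology.IsBounded (Ω : Set (E d))) (hT : 0 < T) {γ : ℝ}
    {U : Set (L2 Ω)} (hU0 : (0 : L2 Ω) ∈ U) (f : H10 Ω) :
    J1 Ω T γ U ω f ≤ ENNReal.ofReal T * ‖toL2 Ω f‖ₑ ^ 2 := by
  obtain ⟨z, hz, hzb⟩ := exists_isWeakSolution_zero hΩ hT ω f
  have h0 := Lp.coeFn_zero (L2 Ω) 2 ((volume : Measure ℝ).restrict (Ioc 0 T))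
  have hc : (0 : L2Time T (L2 Ω)) ∈ controls Ω T U := by
    filter_upwards [h0] with t ht
    rwa [ht]
  refine (iInf₂_le _ hc).trans ((iInf₂_le z hz).trans ?_)
  calc _ ≤ ∫⁻ t in Ioc 0 T, ‖toL2 Ω f‖ₑ ^ 2 := by
        refine lintegral_mono_ae ?_
        filter_upwards [h0, hzb] with t h1 h2
        rw [h1]
        simp only [Pi.zero_apply, enorm_zero, ne_eq, OfNat.ofNat_ne_zero, not_false_eq_true,
          zero_pow, mul_zero, add_zero]
        gcongr
        exact enorm_le_iff_norm_le.2 h2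
    _ = _ := by simp [mul_comm]

/-- Adding a solution of the homogeneous equation changes the initial value of any admissible pair
without changing its control. -/
theorem J1_le_add (hΩ : Bornology.IsBounded (Ω : Set (E d))) (hT : 0 < T) {γ : ℝ}
    {U : Set (L2 Ω)} (f f' : H10 Ω) {δ : ℝ} (hδ : 0 < δ) :
    J1 Ω T γ U ω f' ≤ ENNReal.ofReal (1 + δ) * J1 Ω T γ U ω f +
      ENNReal.ofReal (1 + δ⁻¹) * (ENNReal.ofReal T * ‖toL2 Ω (f' - f)‖ₑ ^ 2) := by
  obtain ⟨z, hz, hzb⟩ := exists_isWeakSolution_zero hΩ hT ω (f' - f)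
  have hδ0 : ENNReal.ofReal (1 + δ) ≠ 0 := by simp; positivity
  have key : ∀ u ∈ controls Ω T U, ∀ y, IsWeakSolution Ω T ω u f y →
      J1 Ω T γ U ω f' ≤ ENNReal.ofReal (1 + δ) *
        (∫⁻ t in Ioc 0 T, (‖toL2 Ω (y t)‖ₑ ^ 2 + ENNReal.ofReal γ * ‖u t‖ₑ ^ 2)) +
      ENNReal.ofReal (1 + δ⁻¹) * (ENNReal.ofReal T * ‖toL2 Ω (f' - f)‖ₑ ^ 2) := by
    intro u hu y hy
    have hyz := hy.add_zero_control hz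
    rw [add_sub_cancel] at hyz
    refine (iInf₂_le u hu).trans ((iInf₂_le _ hyz).trans ?_)
    calc _ ≤ ∫⁻ t in Ioc 0 T, (ENNReal.ofReal (1 + δ) *
            (‖toL2 Ω (y t)‖ₑ ^ 2 + ENNReal.ofReal γ * ‖u t‖ₑ ^ 2) +
            ENNReal.ofReal (1 + δ⁻¹) * ‖toL2 Ω (f' - f)‖ₑ ^ 2) := by
          refine lintegral_mono_ae ?_
          filter_upwards [hzb, Lp.coeFn_add y z] with t h1 h2
          rw [h2, Pi.add_apply, map_add]
          have h3 : ‖toL2 Ω (z t)‖ₑ ≤ ‖toL2 Ω (f' - f)‖ₑ := enorm_le_iff_norm_le.2 h1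
          have h4 : (1 : ℝ≥0∞) ≤ ENNReal.ofReal (1 + δ) := by
            rw [← ENNReal.ofReal_one]
            exact ENNReal.ofReal_le_ofReal (by linarith)
          calc _ ≤ (ENNReal.ofReal (1 + δ) * ‖toL2 Ω (y t)‖ₑ ^ 2 +
                ENNReal.ofReal (1 + δ⁻¹) * ‖toL2 Ω (z t)‖ₑ ^ 2) +
                ENNReal.ofReal (1 + δ) * (ENNReal.ofReal γ * ‖u t‖ₑ ^ 2) :=
                add_le_add (enorm_add_sq_le_young _ _ hδ) (le_mul_of_one_le_left' h4)
            _ ≤ (ENNReal.ofReal (1 + δ) * ‖toL2 Ω (y t)‖ₑ ^ 2 +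
                ENNReal.ofReal (1 + δ⁻¹) * ‖toL2 Ω (f' - f)‖ₑ ^ 2) +
                ENNReal.ofReal (1 + δ) * (ENNReal.ofReal γ * ‖u t‖ₑ ^ 2) := by gcongr
            _ = _ := by ring
      _ = _ := by
          rw [lintegral_add_right _ measurable_const, lintegral_const_mul' _ _ (by simp)]
          simp
          ring
  rw [← tsub_le_iff_right, mul_comm _ (J1 Ω T γ U ω f), ← ENNReal.div_le_iff_le_mul (Or.inl hδ0) (Or.inl (by simp))]
  refine le_iInf₂ fun u hu => le_iInf₂ fun y hy => ?_
  rw [ENNReal.div_le_iff_le_mul (Or.inl hδ0) (Or.inl (by simp)),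
    tsub_le_iff_right, mul_comm _ (ENNReal.ofReal (1 + δ))]
  exact key u hu y hy

/-- Upper semicontinuity of `J1` with respect to the `L₂(Ω)` distance of the initial values. -/
theorem le_J1_of_tendsto (hΩ : Bornology.IsBounded (Ω : Set (E d))) (hT : 0 < T) {γ : ℝ}
    {U : Set (L2 Ω)} (hU0 : (0 : L2 Ω) ∈ U) {f : ℕ → H10 Ω} {a : H10 Ω} {M : ℝ≥0∞}
    (hf : Tendsto (fun n => toL2 Ω (f n)) atTop (𝓝 (toL2 Ω a)))
    (hM : Tendsto (fun n => J1 Ω T γ U ω (f n)) atTop (𝓝 M)) : M ≤ J1 Ω T γ U ω a := by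
  have hfin : J1 Ω T γ U ω a ≠ ⊤ :=
    ((J1_le hΩ hT hU0 a).trans_lt (ENNReal.mul_lt_top (by simp) (by simp))).ne
  have h1 : ∀ δ : ℝ, 0 < δ → M ≤ ENNReal.ofReal (1 + δ) * J1 Ω T γ U ω a := by
    intro δ hδ
    refine le_of_tendsto_of_tendsto' hM ?_ fun n => J1_le_add hΩ hT a (f n) hδ
    have h2 : Tendsto (fun n => ‖toL2 Ω (f n - a)‖ₑ ^ 2) atTop (𝓝 0) := by
      have := ENNReal.Tendsto.pow (n := 2) (hf.sub_const (toL2 Ω a)).enorm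
      simpa using this
    have h3 := (ENNReal.Tendsto.const_mul (a := ENNReal.ofReal (1 + δ⁻¹))
      (ENNReal.Tendsto.const_mul (a := ENNReal.ofReal T) h2 (Or.inr (by simp)))
      (Or.inr (by simp))).const_add (ENNReal.ofReal (1 + δ) * J1 Ω T γ U ω a)
    simpa using h3
  have h4 : Tendsto (fun δ : ℝ => ENNReal.ofReal (1 + δ) * J1 Ω T γ U ω a) (𝓝[>] 0)
      (𝓝 (J1 Ω T γ U ω a)) := by
    have hc : Continuous fun δ : ℝ => ENNReal.ofReal (1 + δ) * J1 Ω T γ U ω a :=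
      (ENNReal.continuous_mul_const hfin).comp
        (ENNReal.continuous_ofReal.comp (by fun_prop))
    simpa using (hc.tendsto 0).mono_left nhdsWithin_le_nhds
  exact ge_of_tendsto h4 (eventually_nhdsWithin_of_forall h1)

end HeatActuator

open Filter Topology in
/-- The supremum `𝒥₂(ω)` is finite and attained at an admissible initial condition. -/
theorem lemma2p3 {d : ℕ} (Ω : TopologicalSpace.Opens (HeatActuator.E d))
    (hΩ : Bornology.IsBounded (Ω : Set (HeatActuator.E d)))
    (T γ : ℝ) (hT : 0 < T) (hγ : 0 < γ)
    (U : Set (HeatActuator.L2 Ω)) (hUclosed : IsClosed U) (hUconvex : Convex ℝ U)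
    (hU0 : (0 : HeatActuator.L2 Ω) ∈ U)
    (K : Set (HeatActuator.H10 Ω))
    (hK : IsClosed (toWeakSpace ℝ (HeatActuator.H10 Ω) '' K))
    (hKne : ∃ f ∈ K, ‖f‖ ≤ 1)
    (ω : Set (HeatActuator.E d)) (hωΩ : ω ⊆ (Ω : Set (HeatActuator.E d)))
    (hω : MeasureTheory.NullMeasurableSet ω MeasureTheory.volume) :
    HeatActuator.J2 Ω T γ U K ω < ⊤ ∧
      ∃ f ∈ K, ‖f‖ ≤ 1 ∧
        HeatActuator.J2 Ω T γ U K ω = HeatActuator.J1 Ω T γ U ω f := by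
  open HeatActuator in
  constructor
  · refine lt_of_le_of_lt (iSup₂_le fun f hf => ?_) (ENNReal.ofReal_lt_top (r := T))
    refine (J1_le hΩ hT hU0 f).trans (mul_le_of_le_one_right' (pow_le_one' ?_ 2))
    rw [← ofReal_norm, ← ENNReal.ofReal_one]
    exact ENNReal.ofReal_le_ofReal ((norm_toL2_le f).trans hf.2)
  · let S : Set (H10 Ω) := {f | f ∈ K ∧ ‖f‖ ≤ 1}
    have hJ2 : J2 Ω T γ U K ω = sSup (J1 Ω T γ U ω '' S) := by
      rw [sSup_image]; rfl
    obtain ⟨m, -, hm, hmS⟩ := exists_seq_tendsto_sSup (S := J1 Ω T γ U ω '' S)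
      (Set.Nonempty.image _ hKne) (OrderTop.bddAbove _)
    rw [← hJ2] at hm
    choose f hfS hfm using hmS
    obtain ⟨a, ha, σ, hσ, hw⟩ := exists_subseq_tendsto_inner (x := f) (r := 1) fun n => (hfS n).2
    have haK : a ∈ K := by
      have hlim : Tendsto (fun n => toWeakSpace ℝ (H10 Ω) (f (σ n))) atTop
          (𝓝 (toWeakSpace ℝ (H10 Ω) a)) := tendsto_toWeakSpace hw
      obtain ⟨b, hb, hba⟩ := hK.mem_of_tendsto hlim
        (Eventually.of_forall fun n => Set.mem_image_of_mem _ (hfS (σ n)).1)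
      rwa [← (toWeakSpace ℝ (H10 Ω)).injective hba]
    refine ⟨a, haK, ha, le_antisymm ?_ (le_iSup₂_of_le a ⟨haK, ha⟩ le_rfl)⟩
    have hstrong : Tendsto (fun n => toL2 Ω (f (σ n))) atTop (𝓝 (toL2 Ω a)) := by
      have h := tendsto_toL2_of_tendsto_inner hΩ (x := fun n => f (σ n) - a) (r := 2)
        (fun n => (norm_sub_le _ _).trans (by linarith [(hfS (σ n)).2]))
        (fun v => by simpa only [inner_sub_left, sub_self] using (hw v).sub_const (inner ℝ a v))
      simpa using h.add_const (toL2 Ω a)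
    refine le_J1_of_tendsto hΩ hT hU0 hstrong ?_
    simpa only [Function.comp_def, hfm] using hm.comp hσ.tendsto_atTop
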